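/- Let $\mathbb{N}=\{1,2,3,\dots\}$ and $\mathbb{C}_0=\{s\in\mathbb{C}:\operatorname{Re} s>0\}$. Let $\mathscr{H}^\infty$ be the set of all functions $f:\mathbb{C}_0\to\mathbb{C}$ that are given by a Dirichlet series $f(s)=\sum_{n=1}^\infty a_n n^{-s}$ (with $a_n\in\mathbb{C}$) converging at every $s\in\mathbb{C}_0$ and that satisfy $\sup_{s\in\mathbb{C}_0}|f(s)|<\infty$, with pointwise operations. For $S\subset\mathbb{N}$, let $\mathscr{H}^\infty_S$ be the set of all $f=\sum_{n=1}^\infty a_n n^{-s}\in\mathscr{H}^\infty$ such that $a_n=0$ for all $n\in\mathbb{N}\setminus S$. Let $(\mathscr{H}^\infty_S)^{-1}$ be the set of all $f\in\mathscr{H}^\infty_S$ that are invertible in $\mathscr{H}^\infty_S$, i.e. for which there is a $g\in\mathscr{H}^\infty_S$ with $f(s)g(s)=1$ for all $s\in\mathbb{C}_0$. **Theorem.** Let $S$ be a multiplicative subsemigroup of $\mathbb{N}$ (i.e. $mn\in S$ for all $m,n\in S$). Then $$(\mathscr{H}^\infty_S)^{-1}=\Big\{f\in\mathscr{H}^\infty_S:\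 \inf_{s\in\mathbb{C}_0}|f(s)|>0\Big\}.$$ -/

import Mathlib

open Filter Topology

noncomputable section

/-- The open right half-plane of complex numbers with positive real part. -/
abbrev RightHalfPlane : Type := {s : ℂ // 0 < s.re}

/-- The Dirichlet series `∑_{n ≥ 1} a n * n ^ (-s)` converges (possibly only conditionally) to
`f s` at every point `s` of the open right half-plane. The value `a 0` plays no role. -/
def HasDirichletSeries (f : RightHalfPlane → ℂ) (a : ℕ → ℂ) : Prop :=
  ∀ s : RightHalfPlane,
    Tendsto (fun N : ℕ => ∑ n ∈ Finset.Icc 1 N, a n * (n : ℂ) ^ (-(s : ℂ))) atTop (𝓝 (f s))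

/-- The Hardy algebra of Dirichlet series, as a set of functions on the right half-plane:
the bounded functions that are sums of an everywhere convergent Dirichlet series. -/
def DirichletHInfty : Set (RightHalfPlane → ℂ) :=
  {f | (∃ a : ℕ → ℂ, HasDirichletSeries f a) ∧
    BddAbove (Set.range fun s : RightHalfPlane => ‖f s‖)}

/-- The elements of the Hardy algebra whose `n`-th coefficient vanishes for every positive
integer `n` outside `S`. -/
def DirichletHInftyOn (S : Set ℕ+) : Set (RightHalfPlane → ℂ) :=
  {f ∈ DirichletHInfty | ∃ a : ℕ → ℂ, HasDirichletSeries f a ∧ ∀ n : ℕ+, n ∉ S → a n = 0}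

/-- The invertible elements of a set `A` of functions with pointwise multiplication: those
elements that have an inverse belonging to `A`. Here `1` is the constant function,
the unit of the Hardy algebra. -/
def invertibleIn (A : Set (RightHalfPlane → ℂ)) : Set (RightHalfPlane → ℂ) :=
  {f ∈ A | ∃ g ∈ A, f * g = 1}

end

/-! If `f * g = 1` with `‖g‖ ≤ M`, then `‖f‖ ≥ 1 / M`. Conversely, let `‖f‖ ≥ δ > 0`. Then `1 / f`
is analytic and bounded by `1 / δ`, and its coefficients should be the Dirichlet inverse of those of
`f`. That inverse exists because the first coefficient of `f` is its limit at `+∞`, hence nonzero.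
It is supported on `S` because `S` is closed under products, and it grows polynomially
(`exists_norm_dirichletInverse_le`), so its series converges absolutely to `1 / f` far to the right.

Convergence on all of `Re s > 0` is Bohr's theorem, `tendsto_sum_Icc_of_bounded`. Integrating `F (s
+ i t)` against a kernel whose Fourier transform is a trapezoid with its slopes between `log N` and
`log (N + 1)` isolates the `N`-th partial sum exactly. The normalized kernel has `L¹` norm `O(N ^
ε)`, so the partial sums are `O(N ^ ε)` uniformly in `s` (`exists_norm_partialSum_le`). Summation by
parts turns this into convergence. -/

open MeasureTheory

/-! ### Fourier transform of the trapezoid kernel -/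

/-- The integral of `(1 - cos t) / t ^ 2` over the real line. -/
noncomputable def oneSubCosIntegral : ℝ := ∫ t : ℝ, (1 - Real.cos t) / t ^ 2

theorem integrable_one_sub_cos_div_sq (a : ℝ) :
    Integrable fun t : ℝ => (1 - Real.cos (a * t)) / t ^ 2 := by
  refine Integrable.mono' (integrable_inv_one_add_sq.const_mul (a ^ 2 / 2 + 2))
    (Measurable.aestronglyMeasurable (by fun_prop)) (ae_of_all _ fun t => ?_)
  have h0 : 0 ≤ 1 - Real.cos (a * t) := by linarith [Real.cos_le_one (a * t)]
  rw [Real.norm_of_nonneg (by positivity)]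
  rcases eq_or_ne t 0 with rfl | ht
  · simp; positivity
  have ht2 : 0 < t ^ 2 := by positivity
  rw [← div_eq_mul_inv, div_le_div_iff₀ ht2 (by positivity)]
  have h1 : 1 - Real.cos (a * t) ≤ (a * t) ^ 2 / 2 := by
    linarith [Real.one_sub_sq_div_two_le_cos (x := a * t)]
  have h2 : 1 - Real.cos (a * t) ≤ 2 := by linarith [Real.neg_one_le_cos (a * t)]
  nlinarith [mul_le_mul_of_nonneg_right h2 ht2.le]

/-- Scaling `t ↦ a t`. The value of the constant is never needed, only its positivity. -/
theorem integral_one_sub_cos_div_sq (a : ℝ) :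
    ∫ t : ℝ, (1 - Real.cos (a * t)) / t ^ 2 = |a| * oneSubCosIntegral := by
  rcases eq_or_ne a 0 with rfl | ha
  · simp
  have h : ∀ t : ℝ, (1 - Real.cos (a * t)) / t ^ 2 =
      a ^ 2 * ((1 - Real.cos (a * t)) / (a * t) ^ 2) := fun t => by
    rcases eq_or_ne t 0 with rfl | ht
    · simp
    · field_simp
  simp_rw [h]
  rw [integral_const_mul, Measure.integral_comp_mul_left (fun u => (1 - Real.cos u) / u ^ 2) a,
    oneSubCosIntegral, smul_eq_mul, abs_inv, ← sq_abs]
  have := abs_pos.mpr ha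
  field_simp

theorem oneSubCosIntegral_pos : 0 < oneSubCosIntegral := by
  have hint : Integrable fun t : ℝ => (1 - Real.cos t) / t ^ 2 := by
    simpa using integrable_one_sub_cos_div_sq 1
  have hnn : ∀ t : ℝ, 0 ≤ (1 - Real.cos t) / t ^ 2 := fun t =>
    div_nonneg (by linarith [Real.cos_le_one t]) (sq_nonneg t)
  rw [oneSubCosIntegral, integral_pos_iff_support_of_nonneg hnn hint]
  refine lt_of_lt_of_le ?_ (measure_mono (s := Set.Ioo 0 1) fun t ht => ?_)
  · simp
  · have h1 : Real.cos t < 1 := by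
      simpa using Real.cos_lt_cos_of_nonneg_of_le_pi le_rfl
        (ht.2.le.trans (by linarith [Real.pi_gt_three])) ht.1
    exact (div_pos (by linarith) (pow_pos ht.1 2)).ne'

/-- Up to a constant, the inverse Fourier transform of the trapezoid that is constant on `[-p, p]`
and vanishes outside `[-q, q]`. -/
noncomputable def trapezoidKernel (p q t : ℝ) : ℝ := (Real.cos (p * t) - Real.cos (q * t)) / t ^ 2

theorem trapezoidKernel_eq (p q t : ℝ) : trapezoidKernel p q t =
    (1 - Real.cos (q * t)) / t ^ 2 - (1 - Real.cos (p * t)) / t ^ 2 := by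
  rw [trapezoidKernel]; ring

theorem integrable_trapezoidKernel (p q : ℝ) : Integrable (trapezoidKernel p q) := by
  simp_rw [funext (trapezoidKernel_eq p q)]
  exact (integrable_one_sub_cos_div_sq q).sub (integrable_one_sub_cos_div_sq p)

theorem trapezoidKernel_mul_cos (p q x t : ℝ) : trapezoidKernel p q t * Real.cos (x * t) =
    (trapezoidKernel (p + x) (q + x) t + trapezoidKernel (p - x) (q - x) t) / 2 := by
  simp only [trapezoidKernel, add_mul, sub_mul, Real.cos_add, Real.cos_sub]
  ring

theorem integral_trapezoidKernel (p q : ℝ) :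
    ∫ t, trapezoidKernel p q t = (|q| - |p|) * oneSubCosIntegral := by
  simp_rw [trapezoidKernel_eq]
  rw [integral_sub (integrable_one_sub_cos_div_sq q) (integrable_one_sub_cos_div_sq p),
    integral_one_sub_cos_div_sq, integral_one_sub_cos_div_sq]
  ring

theorem integral_trapezoidKernel_mul_cos (p q x : ℝ) :
    ∫ t, trapezoidKernel p q t * Real.cos (x * t) =
      (|q + x| - |p + x| + (|q - x| - |p - x|)) / 2 * oneSubCosIntegral := by
  simp_rw [trapezoidKernel_mul_cos]
  rw [integral_div, integral_add (integrable_trapezoidKernel _ _) (integrable_trapezoidKernel _ _),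
    integral_trapezoidKernel, integral_trapezoidKernel]
  ring

theorem integral_trapezoidKernel_mul_sin (p q x : ℝ) :
    ∫ t, trapezoidKernel p q t * Real.sin (x * t) = 0 := by
  have h := integral_neg_eq_self (fun t => trapezoidKernel p q t * Real.sin (x * t)) volume
  have h' : ∀ t, trapezoidKernel p q (-t) * Real.sin (x * -t) =
      -(trapezoidKernel p q t * Real.sin (x * t)) := fun t => by
    simp [trapezoidKernel]
  simp_rw [h', integral_neg] at h
  linarith

/-- For `0 ≤ p ≤ q` the right side is the trapezoid: `(q - p) * oneSubCosIntegral` when `|x| ≤ p`,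
and `0` when `|x| ≥ q`. -/
theorem integral_cexp_mul_trapezoidKernel (p q x : ℝ) :
    ∫ t : ℝ, Complex.exp (-(x * t) * Complex.I) * trapezoidKernel p q t =
      (((|q + x| - |p + x| + (|q - x| - |p - x|)) / 2 * oneSubCosIntegral : ℝ) : ℂ) := by
  have h : ∀ t : ℝ, Complex.exp (-(x * t) * Complex.I) * trapezoidKernel p q t =
      ((trapezoidKernel p q t * Real.cos (x * t) : ℝ) : ℂ) -
        ((trapezoidKernel p q t * Real.sin (x * t) : ℝ) : ℂ) * Complex.I := fun t => by
    rw [Complex.exp_mul_I, Complex.cos_neg, Complex.sin_neg]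
    push_cast
    ring
  have hc : Integrable fun t => trapezoidKernel p q t * Real.cos (x * t) :=
    (integrable_trapezoidKernel p q).mul_bdd (c := 1) (by fun_prop)
      (ae_of_all _ fun t => by simpa using Real.abs_cos_le_one _)
  have hs : Integrable fun t => trapezoidKernel p q t * Real.sin (x * t) :=
    (integrable_trapezoidKernel p q).mul_bdd (c := 1) (by fun_prop)
      (ae_of_all _ fun t => by simpa using Real.abs_sin_le_one _)
  simp_rw [h]
  rw [integral_sub hc.ofReal (hs.ofReal.mul_const _), integral_mul_const,
    integral_complex_ofReal, integral_complex_ofReal, integral_trapezoidKernel_mul_sin, integral_trapezoidKernel_mul_cos]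
  simp

/-! ### The `L¹` norm of the trapezoid kernel -/

/-- An integrable majorant for the normalized trapezoid kernels. -/
noncomputable def kernelMajorant (ε t : ℝ) : ℝ :=
  if |t| ≤ 1 then |t| ^ (ε - 1) else |t| ^ (-1 - ε)

theorem kernelMajorant_nonneg (ε t : ℝ) : 0 ≤ kernelMajorant ε t := by
  unfold kernelMajorant; split_ifs <;> positivity

theorem integrable_kernelMajorant {ε : ℝ} (hε : 0 < ε) : Integrable (kernelMajorant ε) := by
  have h : IntegrableOn (fun t : ℝ => if t ≤ 1 then t ^ (ε - 1) else t ^ (-1 - ε)) (Set.Ioi 0) := by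
    rw [← Set.Ioc_union_Ioi_eq_Ioi zero_le_one]
    refine IntegrableOn.union ?_ ?_
    · refine IntegrableOn.congr_fun (f := fun t : ℝ => t ^ (ε - 1)) ?_ (fun t ht => ?_)
        measurableSet_Ioc
      · rw [← intervalIntegrable_iff_integrableOn_Ioc_of_le zero_le_one]
        exact intervalIntegral.intervalIntegrable_rpow' (by linarith)
      · simp [ht.2]
    · refine IntegrableOn.congr_fun (f := fun t : ℝ => t ^ (-1 - ε)) ?_ (fun t ht => ?_)
        measurableSet_Ioi
      · exact integrableOn_Ioi_rpow_of_lt (by linarith) one_pos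
      · simp [not_le.mpr (Set.mem_Ioi.mp ht)]
  have h' : IntegrableOn (kernelMajorant ε) (Set.Ioi 0) :=
    h.congr_fun (fun t ht => by simp [kernelMajorant, abs_of_pos (Set.mem_Ioi.mp ht)])
      measurableSet_Ioi
  have h'' : IntegrableOn (kernelMajorant ε) (Set.Iic 0) := by
    rw [integrableOn_Iic_iff_integrableOn_Iio]
    have := ((Measure.measurePreserving_neg (volume : Measure ℝ)).integrableOn_comp_preimage
      (MeasurableEquiv.neg ℝ).measurableEmbedding).mpr h'
    have heven : ∀ t, kernelMajorant ε (-t) = kernelMajorant ε t := by simp [kernelMajorant]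
    simpa [Function.comp_def, heven] using this
  rw [← integrableOn_univ, ← Set.Iic_union_Ioi (a := (0 : ℝ))]
  exact h''.union h'

theorem le_rpow_mul_rpow {m x y ε : ℝ} (hm : 0 ≤ m) (hx : m ≤ x) (hy : m ≤ y) (h0 : 0 ≤ ε)
    (h1 : ε ≤ 1) : m ≤ x ^ ε * y ^ (1 - ε) := by
  calc m = m ^ ε * m ^ (1 - ε) := by
        rw [← Real.rpow_add_of_nonneg hm h0 (by linarith)]; simp
    _ ≤ _ := by
        have := hm.trans hx
        gcongr

theorem abs_cos_sub_cos_eq (x y : ℝ) :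
    |Real.cos x - Real.cos y| = 2 * |Real.sin ((x + y) / 2)| * |Real.sin ((x - y) / 2)| := by
  rw [Real.cos_sub_cos, abs_mul, abs_mul]; simp

/-- Interpolation between two bounds for the kernel divided by `q - p`: `1 / |t|` everywhere, and
`X` or `X / t ^ 2` according as `|t| ≤ 1` or not. Weights `1 - ε` and `ε` make the result integrable
both at `0` and at infinity, at the cost of `X ^ ε`. -/
theorem abs_trapezoidKernel_le {p q X ε : ℝ} (hp : 0 ≤ p) (hpq : p < q) (hX : q ≤ X)
    (hX' : 2 ≤ (q - p) * X) (h0 : 0 ≤ ε) (h1 : ε ≤ 1) {t : ℝ} (ht : t ≠ 0) :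
    |trapezoidKernel p q t| ≤ (q - p) * X ^ ε * kernelMajorant ε t := by
  have hd : 0 < q - p := by linarith
  have hX0 : 0 < X := by linarith
  have ht' : 0 < |t| := abs_pos.mpr ht
  set m := |trapezoidKernel p q t| / (q - p) with hm
  suffices h : m ≤ X ^ ε * kernelMajorant ε t by
    rw [hm, div_le_iff₀ hd] at h; linarith
  have hm0 : 0 ≤ m := by positivity
  have hK : |trapezoidKernel p q t| = 2 * |Real.sin ((p * t + q * t) / 2)| *
      |Real.sin ((p * t - q * t) / 2)| / |t| ^ 2 := by
    rw [trapezoidKernel, abs_div, abs_cos_sub_cos_eq, abs_pow]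
  have hs1 : |Real.sin ((p * t + q * t) / 2)| ≤ (p + q) / 2 * |t| := by
    refine Real.abs_sin_le_abs.trans_eq ?_
    rw [← add_mul, mul_div_right_comm, abs_mul, abs_of_nonneg (by linarith)]
  have hs2 : |Real.sin ((p * t - q * t) / 2)| ≤ (q - p) / 2 * |t| := by
    refine Real.abs_sin_le_abs.trans_eq ?_
    rw [← sub_mul, mul_div_right_comm, abs_mul, abs_of_nonpos (by linarith)]
    ring
  have hs1' := Real.abs_sin_le_one ((p * t + q * t) / 2)
  have hs2' := Real.abs_sin_le_one ((p * t - q * t) / 2)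
  have b1 : m ≤ |t|⁻¹ := by
    rw [hm, hK, div_le_iff₀ hd, div_le_iff₀ (by positivity)]
    calc _ ≤ 2 * 1 * ((q - p) / 2 * |t|) := by gcongr
      _ = _ := by field_simp
  rw [kernelMajorant]
  split_ifs with h
  · have b2 : m ≤ X := by
      rw [hm, hK, div_le_iff₀ hd, div_le_iff₀ (by positivity)]
      have : 0 ≤ p + q := by linarith
      calc _ ≤ 2 * ((p + q) / 2 * |t|) * ((q - p) / 2 * |t|) := by gcongr
        _ = (p + q) / 2 * ((q - p) * |t| ^ 2) := by ring
        _ ≤ X * ((q - p) * |t| ^ 2) := by gcongr; linarith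
        _ = _ := by ring
    refine (le_rpow_mul_rpow hm0 b2 b1 h0 h1).trans_eq ?_
    rw [Real.inv_rpow ht'.le, ← Real.rpow_neg ht'.le, neg_sub]
  · have b2 : m ≤ X * |t| ^ (-2 : ℝ) := by
      rw [hm, hK, div_le_iff₀ hd, Real.rpow_neg ht'.le, Real.rpow_two, ← div_eq_mul_inv,
        div_mul_eq_mul_div]
      refine div_le_div_of_nonneg_right ?_ (by positivity)
      calc _ ≤ 2 * (1 : ℝ) * 1 := by gcongr
        _ ≤ _ := by linarith
    refine (le_rpow_mul_rpow hm0 b2 b1 h0 h1).trans_eq ?_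
    rw [Real.inv_rpow ht'.le, ← Real.rpow_neg ht'.le, Real.mul_rpow hX0.le (by positivity),
      ← Real.rpow_mul ht'.le, mul_assoc, ← Real.rpow_add ht']
    ring_nf

theorem integral_abs_trapezoidKernel_le {p q X ε : ℝ} (hp : 0 ≤ p) (hpq : p < q) (hX : q ≤ X)
    (hX' : 2 ≤ (q - p) * X) (h0 : 0 < ε) (h1 : ε ≤ 1) :
    ∫ t, |trapezoidKernel p q t| ≤ (q - p) * X ^ ε * ∫ t, kernelMajorant ε t := by
  rw [← integral_const_mul]
  refine integral_mono_ae (integrable_trapezoidKernel p q).abs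
    ((integrable_kernelMajorant h0).const_mul _) ?_
  filter_upwards [compl_mem_ae_iff.mpr (measure_singleton (μ := volume) (0 : ℝ))] with t ht
  exact abs_trapezoidKernel_le hp hpq hX hX' h0.le h1 ht

/-! ### Partial sums as vertical averages -/

theorem isOpen_re_gt (x : ℝ) : IsOpen {s : ℂ | x < s.re} :=
  isOpen_lt continuous_const Complex.continuous_re

/-- Differentiation under the integral; Cauchy's estimate on discs of radius `ρ` bounds `F'` by `M /
ρ` uniformly along vertical lines. -/
theorem differentiableOn_integral_vertical {F : ℂ → ℂ} {M : ℝ} {K : ℝ → ℝ}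
    (hF : DifferentiableOn ℂ F {s | 0 < s.re}) (hM : ∀ s : ℂ, 0 < s.re → ‖F s‖ ≤ M)
    (hK : Integrable K) :
    DifferentiableOn ℂ (fun s => ∫ t : ℝ, F (s + t * Complex.I) * K t) {s | 0 < s.re} := by
  intro s₀ hs₀
  have hs₀ : 0 < s₀.re := hs₀
  have hopen := isOpen_re_gt 0
  have hcont : ∀ (G : ℂ → ℂ), DifferentiableOn ℂ G {s | 0 < s.re} → ∀ z : ℂ, 0 < z.re →
      Continuous fun t : ℝ => G (z + t * Complex.I) := fun G hG z hz =>
    hG.continuousOn.comp_continuous (by fun_prop) (fun t => by simpa using hz)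
  have hKm : AEStronglyMeasurable (fun t => (K t : ℂ)) := hK.ofReal.aestronglyMeasurable
  set ρ := s₀.re / 3 with hρ
  have hρ0 : 0 < ρ := by positivity
  have hre : ∀ z ∈ Metric.ball s₀ ρ, 2 * ρ < z.re := fun z hz => by
    have h1 := (Complex.abs_re_le_norm (z - s₀)).trans_lt (mem_ball_iff_norm.mp hz)
    rw [Complex.sub_re, abs_lt] at h1
    linarith [h1.1]
  refine DifferentiableAt.differentiableWithinAt (HasDerivAt.differentiableAt
    (hasDerivAt_integral_of_dominated_loc_of_deriv_le (Metric.ball_mem_nhds s₀ hρ0)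
      (F' := fun z t => deriv F (z + t * Complex.I) * K t)
      (bound := fun t => M / ρ * |K t|) ?_ ?_ ?_ ?_ ?_ ?_).2)
  · filter_upwards [hopen.mem_nhds hs₀] with z hz
    exact (hcont F hF z hz).aestronglyMeasurable.mul hKm
  · exact hK.ofReal.bdd_mul (c := M) (hcont F hF s₀ hs₀).aestronglyMeasurable
      (ae_of_all _ fun t => hM _ (by simpa using hs₀))
  · exact (hcont _ (hF.deriv hopen) s₀ hs₀).aestronglyMeasurable.mul hKm
  · refine ae_of_all _ fun t z hz => ?_
    rw [norm_mul, Complex.norm_real, Real.norm_eq_abs]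
    refine mul_le_mul_of_nonneg_right ?_ (abs_nonneg _)
    have hball : ∀ w ∈ Metric.closedBall (z + t * Complex.I) ρ, 0 < w.re := fun w hw => by
      have h1 := (Complex.abs_re_le_norm _).trans (mem_closedBall_iff_norm.mp hw)
      have h2 := hre z hz
      simp only [Complex.sub_re, Complex.add_re, Complex.mul_re, Complex.ofReal_re, Complex.I_re,
        Complex.ofReal_im, Complex.I_im, abs_le] at h1
      linarith [h1.1]
    refine Complex.norm_deriv_le_of_forall_mem_sphere_norm_le hρ0 ?_ fun w hw =>
      hM w (hball w (Metric.sphere_subset_closedBall hw))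
    exact (hF.mono hball).diffContOnCl_ball subset_rfl
  · exact hK.abs.const_mul _
  · refine ae_of_all _ fun t z hz => ?_
    have hz' : 0 < (z + t * Complex.I).re := by
      have := hre z hz
      simp; linarith
    exact ((hF.differentiableAt (hopen.mem_nhds hz')).hasDerivAt.comp_add_const z _).mul_const _

theorem LSeries_term_add_mul_I (b : ℕ → ℂ) (s : ℂ) (t : ℝ) (n : ℕ) :
    LSeries.term b (s + t * Complex.I) n =
      LSeries.term b s n * Complex.exp (-(Real.log n * t) * Complex.I) := by
  rcases eq_or_ne n 0 with rfl | hn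
  · simp
  · have hn' : (n : ℂ) ≠ 0 := Nat.cast_ne_zero.mpr hn
    rw [LSeries.term_of_ne_zero hn, LSeries.term_of_ne_zero hn, Complex.cpow_add _ _ hn',
      ← div_div, div_eq_mul_inv (b n / _), Complex.cpow_def_of_ne_zero hn' (t * _), ← Complex.exp_neg,
      Complex.ofReal_log (Nat.cast_nonneg n)]
    congr 2
    push_cast
    ring

theorem integral_LSeries_mul {b : ℕ → ℂ} {s : ℂ} (hb : LSeriesSummable b s) {K : ℝ → ℝ}
    (hK : Integrable K) :
    ∫ t : ℝ, LSeries b (s + t * Complex.I) * K t =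
      ∑' n, LSeries.term b s n * ∫ t : ℝ, Complex.exp (-(Real.log n * t) * Complex.I) * K t := by
  have hnorm : ∀ (n : ℕ) (t : ℝ), ‖Complex.exp (-(Real.log n * t) * Complex.I)‖ = 1 :=
    fun n t => by
      rw [← Complex.ofReal_mul, ← Complex.ofReal_neg]
      exact Complex.norm_exp_ofReal_mul_I _
  have h := integral_tsum_of_summable_integral_norm (μ := volume)
    (F := fun n (t : ℝ) => LSeries.term b (s + t * Complex.I) n * K t) (fun n => ?_) ?_
  · simp_rw [LSeries, ← tsum_mul_right]
    rw [← h]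
    simp_rw [LSeries_term_add_mul_I, mul_assoc, integral_const_mul]
  · simp_rw [LSeries_term_add_mul_I, mul_assoc]
    refine Integrable.const_mul (hK.ofReal.bdd_mul (c := 1) ?_ ?_) _
    · exact Continuous.aestronglyMeasurable (by fun_prop)
    · exact ae_of_all _ fun t => (hnorm n t).le
  · simp_rw [LSeries_term_add_mul_I, norm_mul, hnorm, mul_one, integral_const_mul]
    exact hb.norm.mul_right _

/-- Every `log n` lies either on the plateau (`n ≤ N`) or outside the support (`n ≥ N + 1`), never
inside a slope, so the average is an exact partial sum. -/
theorem integral_LSeries_mul_trapezoidKernel {b : ℕ → ℂ} {s : ℂ} (hb : LSeriesSummable b s)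
    {N : ℕ} (hN : 0 < N) :
    ∫ t : ℝ, LSeries b (s + t * Complex.I) *
        trapezoidKernel (Real.log N) (Real.log (N + 1)) t =
      ((Real.log (N + 1) - Real.log N) * oneSubCosIntegral : ℝ) *
        ∑ n ∈ Finset.Icc 1 N, b n * (n : ℂ) ^ (-s) := by
  have hN' : (0 : ℝ) < N := Nat.cast_pos.mpr hN
  have hpq : Real.log N ≤ Real.log (N + 1) := Real.log_le_log hN' (by linarith)
  rw [integral_LSeries_mul hb (integrable_trapezoidKernel _ _),
    tsum_eq_sum (s := Finset.Icc 1 N), Finset.mul_sum]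
  · refine Finset.sum_congr rfl fun n hn => ?_
    obtain ⟨h1, h2⟩ := Finset.mem_Icc.mp hn
    have hx : 0 ≤ Real.log n := Real.log_natCast_nonneg n
    have hxp : Real.log n ≤ Real.log N :=
      Real.log_le_log (by exact_mod_cast h1) (by exact_mod_cast h2)
    rw [integral_cexp_mul_trapezoidKernel, abs_of_nonneg (by linarith), abs_of_nonneg (by linarith),
      abs_of_nonneg (by linarith), abs_of_nonneg (by linarith),
      LSeries.term_of_ne_zero (by lia), Complex.cpow_neg]
    push_cast
    ring
  · intro n hn
    rcases Nat.eq_zero_or_pos n with rfl | h0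
    · simp
    have h2 : N + 1 ≤ n := by
      by_contra h
      exact hn (Finset.mem_Icc.mpr ⟨h0, by lia⟩)
    have hx : 0 ≤ Real.log N := Real.log_natCast_nonneg N
    have hxq : Real.log (N + 1) ≤ Real.log n :=
      Real.log_le_log (by linarith) (by exact_mod_cast h2)
    rw [integral_cexp_mul_trapezoidKernel, abs_of_nonneg (by linarith), abs_of_nonneg (by linarith),
      abs_of_nonpos (by linarith), abs_of_nonpos (by linarith)]
    simp only [Complex.ofReal_mul, mul_eq_zero, Complex.ofReal_eq_zero]
    right; left
    ring

theorem eqOn_re_pos_of_eqOn {G H : ℂ → ℂ} {x σ : ℝ} (hG : DifferentiableOn ℂ G {s | x < s.re})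
    (hH : DifferentiableOn ℂ H {s | x < s.re}) (h : ∀ s : ℂ, σ < s.re → G s = H s) {s : ℂ}
    (hs : x < s.re) : G s = H s := by
  have hz : x < ((max x σ + 1 : ℝ) : ℂ).re := by
    rw [Complex.ofReal_re]; linarith [le_max_left x σ]
  have hz' : σ < ((max x σ + 1 : ℝ) : ℂ).re := by
    rw [Complex.ofReal_re]; linarith [le_max_right x σ]
  refine (hG.analyticOnNhd (isOpen_re_gt x)).eqOn_of_preconnected_of_eventuallyEq
    (hH.analyticOnNhd (isOpen_re_gt x)) (convex_halfSpace_re_gt x).isPreconnected hz ?_ hs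
  filter_upwards [(isOpen_re_gt σ).mem_nhds hz'] with w hw using h w hw

/-- The partial sums of the Dirichlet series of a bounded analytic function grow slower than any
power, uniformly on the right half-plane. -/
theorem exists_norm_partialSum_le {F : ℂ → ℂ} {M σ ε : ℝ} {b : ℕ → ℂ}
    (hF : DifferentiableOn ℂ F {s | 0 < s.re}) (hM : ∀ s : ℂ, 0 < s.re → ‖F s‖ ≤ M)
    (hb : ∀ s : ℂ, σ < s.re → LSeriesSummable b s) (hFb : ∀ s : ℂ, σ < s.re → LSeries b s = F s)
    (h0 : 0 < ε) (h1 : ε ≤ 1) :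
    ∃ C, ∀ s : ℂ, 0 < s.re → ∀ N : ℕ,
      ‖∑ n ∈ Finset.Icc 1 N, b n * (n : ℂ) ^ (-s)‖ ≤ C * ((N : ℝ) + 1) ^ ε := by
  have hM0 : 0 ≤ M := (norm_nonneg _).trans (hM 1 (by simp))
  have hc := oneSubCosIntegral_pos
  have hI : 0 ≤ ∫ t, kernelMajorant ε t := integral_nonneg (kernelMajorant_nonneg ε)
  refine ⟨M * 2 ^ ε * (∫ t, kernelMajorant ε t) / oneSubCosIntegral, fun s hs N => ?_⟩
  rcases Nat.eq_zero_or_pos N with rfl | hN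
  · simp; positivity
  have hN' : (0 : ℝ) < N := Nat.cast_pos.mpr hN
  set p := Real.log N
  set q := Real.log (N + 1)
  -- The hypothesis of the kernel bound for `X = 2 (N + 1)`, from `log (1 + 1 / N) ≥ 1 / (N + 1)`.
  have hpq : 2 ≤ (q - p) * (2 * (N + 1)) := by
    have : 1 - ((N + 1 : ℝ) / N)⁻¹ ≤ Real.log ((N + 1) / N) :=
      Real.one_sub_inv_le_log_of_pos (by positivity)
    rw [Real.log_div (by positivity) (by positivity), inv_div] at this
    have h2 : 1 - (N : ℝ) / (N + 1) = 1 / (N + 1) := by field_simp; ring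
    rw [h2, div_le_iff₀ (by positivity)] at this
    linarith
  have hd : 0 < q - p := by
    by_contra h
    nlinarith
  -- Both sides are analytic on `Re s > 0` and agree where the series converges absolutely.
  have key : ∫ t : ℝ, F (s + t * Complex.I) * trapezoidKernel p q t =
      ((q - p) * oneSubCosIntegral : ℝ) * ∑ n ∈ Finset.Icc 1 N, b n * (n : ℂ) ^ (-s) := by
    refine eqOn_re_pos_of_eqOn (x := 0) (σ := max σ 0)
      (G := fun s => ∫ t : ℝ, F (s + t * Complex.I) * trapezoidKernel p q t)
      (H := fun s => ((q - p) * oneSubCosIntegral : ℝ) *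
        ∑ n ∈ Finset.Icc 1 N, b n * (n : ℂ) ^ (-s))
      (differentiableOn_integral_vertical hF hM (integrable_trapezoidKernel p q)) ?_
      (fun s hs => ?_) hs
    · refine DifferentiableOn.const_mul (DifferentiableOn.fun_sum fun n hn => ?_) _
      have hn' : (n : ℂ) ≠ 0 := by
        have := (Finset.mem_Icc.mp hn).1
        exact_mod_cast (by lia : n ≠ 0)
      exact (differentiable_id.neg.const_cpow (Or.inl hn')).differentiableOn.const_mul _
    · have hs : σ < s.re := (le_max_left _ _).trans_lt hs
      rw [← integral_LSeries_mul_trapezoidKernel (hb s hs) hN]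
      congr 1 with t
      rw [hFb _ (by simpa using hs)]
  have hup : ‖∫ t : ℝ, F (s + t * Complex.I) * trapezoidKernel p q t‖ ≤
      M * ((q - p) * (2 * (N + 1)) ^ ε * ∫ t, kernelMajorant ε t) := by
    refine (norm_integral_le_of_norm_le ((integrable_trapezoidKernel p q).abs.const_mul M)
      (ae_of_all _ fun t => ?_)).trans ?_
    · rw [norm_mul, Complex.norm_real, Real.norm_eq_abs]
      exact mul_le_mul_of_nonneg_right (hM _ (by simpa using hs)) (abs_nonneg _)
    · rw [integral_const_mul]
      refine mul_le_mul_of_nonneg_left (integral_abs_trapezoidKernel_le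
        (Real.log_natCast_nonneg N) (by linarith) ?_ hpq h0 h1) hM0
      have := Real.log_le_sub_one_of_pos (x := N + 1) (by positivity)
      linarith
  rw [key, norm_mul, Complex.norm_real, Real.norm_of_nonneg (by positivity),
    Real.mul_rpow (by norm_num) (by positivity)] at hup
  rw [div_mul_eq_mul_div, le_div_iff₀ hc]
  refine le_of_mul_le_mul_left ?_ hd
  linarith

/-! ### Convergence by partial summation -/

theorem norm_cpow_neg_sub_cpow_neg_le (w : ℂ) (hw : 0 ≤ w.re) {n : ℕ} (hn : 0 < n) :
    ‖((n + 1 : ℕ) : ℂ) ^ (-w) - (n : ℂ) ^ (-w)‖ ≤ ‖w‖ * (n : ℝ) ^ (-w.re - 1) := by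
  have hn' : (0 : ℝ) < n := Nat.cast_pos.mpr hn
  have hd : ∀ x ∈ Set.Icc (n : ℝ) (n + 1), HasDerivWithinAt (fun x : ℝ => (x : ℂ) ^ (-w))
      (-w * (x : ℂ) ^ (-w - 1)) (Set.Icc (n : ℝ) (n + 1)) x := fun x hx => by
    have hx0 : 0 < x := hn'.trans_le hx.1
    exact ((Complex.hasStrictDerivAt_cpow_const (Or.inl (by simpa using hx0))).hasDerivAt.comp_ofReal
      ).hasDerivWithinAt
  have hb : ∀ x ∈ Set.Icc (n : ℝ) (n + 1), ‖-w * (x : ℂ) ^ (-w - 1)‖ ≤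
      ‖w‖ * (n : ℝ) ^ (-w.re - 1) := fun x hx => by
    rw [norm_mul, norm_neg, Complex.norm_cpow_eq_rpow_re_of_pos (hn'.trans_le hx.1)]
    refine mul_le_mul_of_nonneg_left ?_ (norm_nonneg _)
    simp only [Complex.sub_re, Complex.neg_re, Complex.one_re]
    exact Real.rpow_le_rpow_of_nonpos hn' hx.1 (by linarith)
  simpa using (convex_Icc (n : ℝ) (n + 1)).norm_image_sub_le_of_norm_hasDerivWithin_le hd hb
    (Set.left_mem_Icc.mpr (by linarith)) (Set.right_mem_Icc.mpr (by linarith))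

theorem sum_Icc_by_parts (u v : ℕ → ℂ) (N : ℕ) :
    ∑ n ∈ Finset.Icc 1 N, u n * v n = (∑ n ∈ Finset.Icc 1 N, u n) * v (N + 1) -
      ∑ k ∈ Finset.range N, (∑ n ∈ Finset.Icc 1 (k + 1), u n) * (v (k + 2) - v (k + 1)) := by
  induction N with
  | zero => simp
  | succ N ih =>
    rw [Finset.sum_range_succ, Finset.sum_Icc_succ_top (by lia), Finset.sum_Icc_succ_top (by lia),
      ih]
    ring

/-- If the partial sums of a Dirichlet series at `s₀` are `O(N ^ ε)`, then the series converges for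
`Re s > Re s₀ + ε` and its sum is analytic there. -/
theorem exists_tendsto_of_partialSum_le {a : ℕ → ℂ} {s₀ : ℂ} {ε C : ℝ} (hε : 0 ≤ ε)
    (h : ∀ N : ℕ, ‖∑ n ∈ Finset.Icc 1 N, a n * (n : ℂ) ^ (-s₀)‖ ≤ C * ((N : ℝ) + 1) ^ ε) :
    ∃ G : ℂ → ℂ, DifferentiableOn ℂ G {s | s₀.re + ε < s.re} ∧ ∀ s : ℂ, s₀.re + ε < s.re →
      Tendsto (fun N : ℕ => ∑ n ∈ Finset.Icc 1 N, a n * (n : ℂ) ^ (-s)) atTop (𝓝 (G s)) := by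
  set A : ℕ → ℂ := fun N => ∑ n ∈ Finset.Icc 1 N, a n * (n : ℂ) ^ (-s₀) with hA
  have hC : 0 ≤ C := by simpa using (norm_nonneg _).trans (h 0)
  let T : ℕ → ℂ → ℂ := fun k s =>
    A (k + 1) * (((k + 2 : ℕ) : ℂ) ^ (-(s - s₀)) - ((k + 1 : ℕ) : ℂ) ^ (-(s - s₀)))
  have hA' : ∀ k : ℕ, ‖A (k + 1)‖ ≤ C * 2 ^ ε * ((k + 1 : ℕ) : ℝ) ^ ε := fun k => by
    refine (h (k + 1)).trans ?_
    rw [mul_assoc, ← Real.mul_rpow (by norm_num) (by positivity)]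
    push_cast
    gcongr
    linarith [(Nat.cast_nonneg k : (0 : ℝ) ≤ k)]
  have hT : ∀ k s, s₀.re + ε < s.re → ‖T k s‖ ≤
      C * 2 ^ ε * ‖s - s₀‖ * ((k + 1 : ℕ) : ℝ) ^ (ε - (s - s₀).re - 1) := fun k s hs => by
    have h1 := norm_cpow_neg_sub_cpow_neg_le (s - s₀) (by simp; linarith) (Nat.succ_pos k)
    simp only [T, norm_mul]
    refine (mul_le_mul (hA' k) h1 (norm_nonneg _) (by positivity)).trans_eq ?_
    rw [show ε - (s - s₀).re - 1 = ε + (-(s - s₀).re - 1) by ring, Real.rpow_add (by positivity)]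
    ring
  have hsummable : ∀ δ : ℝ, 0 < δ → Summable fun k : ℕ => ((k + 1 : ℕ) : ℝ) ^ (-δ - 1) :=
    fun δ hδ => (summable_nat_add_iff 1 (f := fun k : ℕ => (k : ℝ) ^ (-δ - 1))).mpr
      (Real.summable_nat_rpow.mpr (by linarith))
  have hTs : ∀ s : ℂ, s₀.re + ε < s.re → Summable fun k => T k s := fun s hs => by
    refine Summable.of_norm_bounded
      ((hsummable ((s - s₀).re - ε) (by simp; linarith)).mul_left (C * 2 ^ ε * ‖s - s₀‖))
      fun k => (hT k s hs).trans_eq ?_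
    ring_nf
  have hTd : ∀ k, Differentiable ℂ (T k) := fun k => by
    refine Differentiable.const_mul (Differentiable.sub ?_ ?_) _ <;>
    exact Differentiable.const_cpow (by fun_prop) (Or.inl (by exact_mod_cast (by lia)))
  refine ⟨fun s => -∑' k, T k s, ?_, fun s hs => ?_⟩
  · refine DifferentiableOn.neg fun s hs => ?_
    have hs : s₀.re + ε < s.re := hs
    set δ := (s.re - s₀.re - ε) / 2 with hδ
    have hδ0 : 0 < δ := by linarith
    have hball : ∀ w ∈ Metric.ball s δ, s₀.re + ε + δ < w.re := fun w hw => by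
      have h1 := (Complex.abs_re_le_norm (w - s)).trans_lt (mem_ball_iff_norm.mp hw)
      rw [Complex.sub_re, abs_lt] at h1
      linarith [h1.1]
    have := Complex.differentiableOn_tsum_of_summable_norm (U := Metric.ball s δ)
      ((hsummable δ hδ0).mul_left (C * 2 ^ ε * (‖s - s₀‖ + δ)))
      (fun k => (hTd k).differentiableOn) Metric.isOpen_ball fun k w hw => by
        have hw' := hball w hw
        refine (hT k w (by linarith)).trans ?_
        gcongr
        · calc ‖w - s₀‖ = ‖(s - s₀) + (w - s)‖ := by ring_nf
            _ ≤ ‖s - s₀‖ + ‖w - s‖ := norm_add_le _ _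
            _ ≤ _ := by gcongr; exact (mem_ball_iff_norm.mp hw).le
        · exact_mod_cast Nat.succ_pos k
        · simp; linarith
    exact (this.differentiableAt (Metric.ball_mem_nhds s hδ0)).differentiableWithinAt
  · have heq : ∀ N : ℕ, ∑ n ∈ Finset.Icc 1 N, a n * (n : ℂ) ^ (-s) =
        A N * ((N + 1 : ℕ) : ℂ) ^ (-(s - s₀)) - ∑ k ∈ Finset.range N, T k s := fun N => by
      simp only [T, hA]
      rw [← sum_Icc_by_parts (fun n => a n * (n : ℂ) ^ (-s₀)) (fun n => (n : ℂ) ^ (-(s - s₀)))]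
      refine Finset.sum_congr rfl fun n hn => ?_
      have hn' : (n : ℂ) ≠ 0 := by
        have := (Finset.mem_Icc.mp hn).1
        exact_mod_cast (by lia : n ≠ 0)
      rw [mul_assoc, ← Complex.cpow_add _ _ hn']
      ring_nf
    simp_rw [heq]
    rw [← zero_sub (∑' k, T k s)]
    refine Tendsto.sub ?_ (hTs s hs).hasSum.tendsto_sum_nat
    -- The boundary term is `O(N ^ (ε - Re (s - s₀)))`, with negative exponent.
    have hlim : Tendsto (fun N : ℕ => C * ((N + 1 : ℕ) : ℝ) ^ (-((s - s₀).re - ε))) atTop (𝓝 0) := by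
      have h1 := (tendsto_rpow_neg_atTop (y := (s - s₀).re - ε) (by simp; linarith)).comp
        (tendsto_natCast_atTop_atTop.comp (tendsto_add_atTop_nat 1))
      simpa using h1.const_mul C
    refine squeeze_zero_norm (fun N => ?_) hlim
    rw [norm_mul, Complex.norm_natCast_cpow_of_pos (Nat.succ_pos N)]
    refine (mul_le_mul_of_nonneg_right (h N) (by positivity)).trans_eq ?_
    have hN : (0 : ℝ) < (N : ℝ) + 1 := by positivity
    push_cast
    rw [mul_assoc, ← Real.rpow_add hN]
    simp only [Complex.neg_re]
    ring_nf

/-! ### Support and growth of the Dirichlet inverse -/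

namespace ArithmeticFunction

theorem dirichletInverse_apply_ne (f : ArithmeticFunction ℂ) (hf : Invertible (f 1)) {n : ℕ}
    (h0 : n ≠ 0) (h1 : n ≠ 1) : dirichletInverse f hf n =
      - ⅟(f 1) * ∑ d ∈ n.properDivisors, f (n / d) * dirichletInverse f hf d :=
  dirichletInverseFun_apply_ne f hf h0 h1

/-- The Dirichlet inverse is supported on every subsemigroup that supports the function. -/
theorem dirichletInverse_eq_zero_of_notMem (f : ArithmeticFunction ℂ) (hf : Invertible (f 1))
    (S : Subsemigroup ℕ+) (hS : ∀ n : ℕ+, n ∉ S → f n = 0) (n : ℕ+) (hn : n ∉ S) :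
    dirichletInverse f hf n = 0 := by
  have h1S : (1 : ℕ+) ∈ S := by
    by_contra h
    exact (isUnit_of_invertible (f 1)).ne_zero (by simpa using hS 1 h)
  induction n using PNat.strongInductionOn with
  | _ n ih =>
    have hn1 : (n : ℕ) ≠ 1 := fun h => hn (by rwa [PNat.coe_eq_one_iff.mp h])
    rw [dirichletInverse_apply_ne f hf n.ne_zero hn1, Finset.sum_eq_zero, mul_zero]
    intro d hd
    obtain ⟨⟨m, hm⟩, hlt⟩ := Nat.mem_properDivisors.mp hd
    have hd0 : 0 < d := Nat.pos_of_mem_properDivisors hd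
    have hm0 : 0 < m := by
      rcases Nat.eq_zero_or_pos m with rfl | h
      · exact absurd hm (by simp)
      · exact h
    rw [hm, Nat.mul_div_cancel_left _ hd0]
    lift d to ℕ+ using hd0
    lift m to ℕ+ using hm0
    -- As `n = d * m` is outside `S`, so is `d` or `m`; either way the term vanishes.
    by_cases hdS : d ∈ S
    · have hmS : m ∉ S := fun hmS => hn <| by
        have e : n = d * m := PNat.eq (by simpa using hm)
        exact e ▸ S.mul_mem hdS hmS
      rw [hS _ hmS, zero_mul]
    · rw [ih d (PNat.coe_lt_coe _ _ |>.mp hlt) hdS, mul_zero]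

theorem sum_properDivisors_inv_sq_le {n : ℕ} :
    ∑ d ∈ n.properDivisors, (((n / d : ℕ) : ℝ) ^ 2)⁻¹ ≤ ∑' m : ℕ, ((m : ℝ) ^ 2)⁻¹ := by
  calc _ ≤ ∑ d ∈ n.divisors, (((n / d : ℕ) : ℝ) ^ 2)⁻¹ :=
        Finset.sum_le_sum_of_subset_of_nonneg Nat.properDivisors_subset_divisors
          fun _ _ _ => by positivity
    _ = ∑ d ∈ n.divisors, ((d : ℝ) ^ 2)⁻¹ :=
        Nat.sum_div_divisors n fun m => ((m : ℝ) ^ 2)⁻¹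
    _ ≤ _ := (Real.summable_nat_pow_inv.mpr one_lt_two).sum_le_tsum _ fun _ _ => by positivity

/-- The Dirichlet inverse of a function of linear growth has polynomial growth. -/
theorem exists_norm_dirichletInverse_le (f : ArithmeticFunction ℂ) (hf : Invertible (f 1)) {A : ℝ}
    (hA : ∀ n : ℕ, ‖f n‖ ≤ A * n) :
    ∃ (C : ℝ) (k : ℕ), ∀ n : ℕ, ‖dirichletInverse f hf n‖ ≤ C * (n : ℝ) ^ k := by
  set Z : ℝ := ∑' m : ℕ, ((m : ℝ) ^ 2)⁻¹ with hZ
  set r : ℝ := ‖⅟(f 1)‖ with hr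
  have hA0 : 0 ≤ A := by simpa using (norm_nonneg _).trans (hA 1)
  -- Each quotient `m = n / d` is at least `2`, so `m ^ j ≥ 2 ^ j` absorbs the constant `r * A * Z`
  -- of the recursion. Of the three further powers in `j + 3`, one pays for the linear growth of `f`
  -- and two leave the summable `1 / m ^ 2`.
  obtain ⟨j, hj⟩ := pow_unbounded_of_one_lt (r * A * Z) (one_lt_two : (1 : ℝ) < 2)
  refine ⟨r, j + 3, fun n => ?_⟩
  induction n using Nat.strong_induction_on with
  | _ n ih =>
    rcases eq_or_ne n 0 with rfl | h0
    · simp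
    rcases eq_or_ne n 1 with rfl | h1
    · simp [hr]
    rw [dirichletInverse_apply_ne f hf h0 h1, norm_mul, norm_neg]
    refine mul_le_mul_of_nonneg_left ?_ (norm_nonneg _)
    have hterm : ∀ d ∈ n.properDivisors, ‖f (n / d) * dirichletInverse f hf d‖ ≤
        r * A * (n : ℝ) ^ (j + 3) / 2 ^ j * (((n / d : ℕ) : ℝ) ^ 2)⁻¹ := fun d hd => by
      obtain ⟨⟨m, hm⟩, hlt⟩ := Nat.mem_properDivisors.mp hd
      have hd0 : 0 < d := Nat.pos_of_mem_properDivisors hd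
      have hm2 : 2 ≤ m := by
        by_contra h
        have : m = 0 ∨ m = 1 := by lia
        rcases this with rfl | rfl <;> simp_all
      have hm2' : (2 : ℝ) ≤ m := by exact_mod_cast hm2
      have h2 : (2 : ℝ) ^ j ≤ (m : ℝ) ^ j := by gcongr
      rw [norm_mul, hm, Nat.mul_div_cancel_left _ hd0]
      calc _ ≤ A * m * (r * (d : ℝ) ^ (j + 3)) := by
            gcongr
            · exact hA m
            · exact ih d hlt
        _ = r * A * (d : ℝ) ^ (j + 3) * m * 2 ^ j / 2 ^ j := by field_simp
        _ ≤ r * A * (d : ℝ) ^ (j + 3) * m * m ^ j / 2 ^ j := by gcongr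
        _ = _ := by
          push_cast
          have : (m : ℝ) ≠ 0 := by positivity
          field_simp
          rw [mul_pow]
          ring
    calc _ ≤ ∑ d ∈ n.properDivisors, ‖f (n / d) * dirichletInverse f hf d‖ := norm_sum_le _ _
      _ ≤ ∑ d ∈ n.properDivisors,
          r * A * (n : ℝ) ^ (j + 3) / 2 ^ j * (((n / d : ℕ) : ℝ) ^ 2)⁻¹ := Finset.sum_le_sum hterm
      _ ≤ r * A * (n : ℝ) ^ (j + 3) / 2 ^ j * Z := by
        rw [← Finset.mul_sum]
        gcongr
        exact sum_properDivisors_inv_sq_le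
      _ = r * A * Z / 2 ^ j * (n : ℝ) ^ (j + 3) := by ring
      _ ≤ 1 * (n : ℝ) ^ (j + 3) := by
        gcongr
        rw [div_le_one (by positivity)]
        exact hj.le
      _ = _ := one_mul _

end ArithmeticFunction

/-! ### Bohr's theorem -/

theorem exists_norm_le_of_tendsto {u : ℕ → ℂ} {l : ℂ} (h : Tendsto u atTop (𝓝 l)) :
    ∃ C, ∀ n, ‖u n‖ ≤ C := by
  obtain ⟨C, hC⟩ := (Metric.isBounded_range_of_tendsto u h).exists_norm_le
  exact ⟨C, fun n => hC _ ⟨n, rfl⟩⟩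

theorem LSeriesSummable.tendsto_sum_Icc {b : ℕ → ℂ} {s : ℂ} (h : LSeriesSummable b s) :
    Tendsto (fun N : ℕ => ∑ n ∈ Finset.Icc 1 N, b n * (n : ℂ) ^ (-s)) atTop
      (𝓝 (LSeries b s)) := by
  have h1 := (h.LSeriesHasSum.tendsto_sum_nat).comp (tendsto_add_atTop_nat 1)
  refine h1.congr fun N => ?_
  rw [Function.comp_apply, Finset.range_eq_Ico, Finset.sum_eq_sum_Ico_succ_bot (by lia),
    LSeries.term_zero, zero_add]
  refine Finset.sum_congr (by ext; simp) fun n hn => ?_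
  rw [LSeries.term_of_ne_zero (by have := (Finset.mem_Ico.mp hn).1; lia), Complex.cpow_neg,
    div_eq_mul_inv]

/-- **Bohr's theorem**: if a bounded analytic function on the right half-plane is given by an
absolutely convergent Dirichlet series on some smaller half-plane, then this series converges to it
on the whole right half-plane. -/
theorem tendsto_sum_Icc_of_bounded {F : ℂ → ℂ} {M σ : ℝ} {b : ℕ → ℂ}
    (hF : DifferentiableOn ℂ F {s | 0 < s.re}) (hM : ∀ s : ℂ, 0 < s.re → ‖F s‖ ≤ M)
    (hb : ∀ s : ℂ, σ < s.re → LSeriesSummable b s) (hFb : ∀ s : ℂ, σ < s.re → LSeries b s = F s)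
    {s : ℂ} (hs : 0 < s.re) :
    Tendsto (fun N : ℕ => ∑ n ∈ Finset.Icc 1 N, b n * (n : ℂ) ^ (-s)) atTop (𝓝 (F s)) := by
  -- Partial sums at `s.re / 2` of order `N ^ ε` give convergence for real part above `s.re / 2 +
  -- ε`, which must stay below `s.re`.
  set ε := min 1 (s.re / 4) with hε
  have hε0 : 0 < ε := by positivity
  have hε1 : ε ≤ s.re / 4 := min_le_right _ _
  obtain ⟨C, hC⟩ := exists_norm_partialSum_le hF hM hb hFb hε0 (min_le_left _ _)
  have hre : ((s.re / 2 : ℝ) : ℂ).re = s.re / 2 := Complex.ofReal_re _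
  obtain ⟨G, hG, hGlim⟩ := exists_tendsto_of_partialSum_le hε0.le
    (hC ((s.re / 2 : ℝ) : ℂ) (by rw [hre]; linarith))
  rw [hre] at hG hGlim
  have hlt : s.re / 2 + ε < s.re := by linarith
  have : G s = F s := eqOn_re_pos_of_eqOn (σ := max σ (s.re / 2 + ε)) hG
    (hF.mono fun w (hw : _ < w.re) => show 0 < w.re by linarith)
    (fun w hw => by
      have hσ := (le_max_left _ _).trans_lt hw
      rw [← hFb w hσ]
      exact tendsto_nhds_unique (hGlim w ((le_max_right _ _).trans_lt hw))
        (hb w hσ).tendsto_sum_Icc) hlt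
  exact this ▸ hGlim s hlt

/-! ### Analyticity and coefficients of a convergent Dirichlet series -/

/-- Extension by zero of a function on the right half-plane. -/
noncomputable def extendByZero (f : RightHalfPlane → ℂ) (s : ℂ) : ℂ :=
  if h : 0 < s.re then f ⟨s, h⟩ else 0

theorem extendByZero_of_pos (f : RightHalfPlane → ℂ) {s : ℂ} (h : 0 < s.re) :
    extendByZero f s = f ⟨s, h⟩ := dif_pos h

namespace HasDirichletSeries

variable {f : RightHalfPlane → ℂ} {a : ℕ → ℂ}

theorem tendsto_extendByZero (hf : HasDirichletSeries f a) {s : ℂ} (hs : 0 < s.re) :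
    Tendsto (fun N : ℕ => ∑ n ∈ Finset.Icc 1 N, a n * (n : ℂ) ^ (-s)) atTop
      (𝓝 (extendByZero f s)) := by
  rw [extendByZero_of_pos f hs]
  exact hf ⟨s, hs⟩

/-- Convergence at `s.re / 2` bounds the partial sums there: the case `ε = 0` of partial summation.
-/
theorem differentiableOn (hf : HasDirichletSeries f a) :
    DifferentiableOn ℂ (extendByZero f) {s | 0 < s.re} := by
  intro s hs
  have hs : 0 < s.re := hs
  have hre : ((s.re / 2 : ℝ) : ℂ).re = s.re / 2 := Complex.ofReal_re _
  obtain ⟨C, hC⟩ := exists_norm_le_of_tendsto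
    (hf.tendsto_extendByZero (s := ((s.re / 2 : ℝ) : ℂ)) (by rw [hre]; linarith))
  obtain ⟨G, hG, hGlim⟩ := exists_tendsto_of_partialSum_le (s₀ := ((s.re / 2 : ℝ) : ℂ)) le_rfl
    (fun N => (hC N).trans_eq (by rw [Real.rpow_zero, mul_one]))
  rw [hre, add_zero] at hG hGlim
  have hmem : {w : ℂ | s.re / 2 < w.re} ∈ 𝓝 s :=
    (isOpen_re_gt _).mem_nhds (show s.re / 2 < s.re by linarith)
  refine ((hG.differentiableAt hmem).congr_of_eventuallyEq ?_).differentiableWithinAt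
  filter_upwards [hmem] with w hw
  have hw : s.re / 2 < w.re := hw
  exact tendsto_nhds_unique (hf.tendsto_extendByZero (by linarith)) (hGlim w hw)

/-- The terms at `s = 1` are differences of bounded partial sums. -/
theorem exists_norm_coeff_le (hf : HasDirichletSeries f a) :
    ∃ A, ∀ n : ℕ, n ≠ 0 → ‖a n‖ ≤ A * n := by
  obtain ⟨C, hC⟩ := exists_norm_le_of_tendsto (hf.tendsto_extendByZero (s := 1) (by simp))
  refine ⟨C + C, fun n hn => ?_⟩
  obtain ⟨m, rfl⟩ := Nat.exists_eq_succ_of_ne_zero hn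
  have h1 : a (m + 1) * ((m + 1 : ℕ) : ℂ) ^ (-1 : ℂ) =
      ∑ n ∈ Finset.Icc 1 (m + 1), a n * (n : ℂ) ^ (-1 : ℂ) -
        ∑ n ∈ Finset.Icc 1 m, a n * (n : ℂ) ^ (-1 : ℂ) := by
    rw [Finset.sum_Icc_succ_top (by lia)]
    ring
  have h2 : ‖a (m + 1) * ((m + 1 : ℕ) : ℂ) ^ (-1 : ℂ)‖ ≤ C + C := by
    rw [h1]
    exact (norm_sub_le _ _).trans (add_le_add (hC _) (hC _))
  rw [norm_mul, Complex.cpow_neg_one, norm_inv, Complex.norm_natCast, ← div_eq_mul_inv,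
    div_le_iff₀ (by positivity)] at h2
  exact h2

end HasDirichletSeries

/-! ### Inversion of a function bounded below -/

/-- A function with a Dirichlet series that is bounded below has an inverse with a Dirichlet
series, whose coefficients are supported on every subsemigroup that supports those of `f`. -/
theorem exists_hasDirichletSeries_inv {f : RightHalfPlane → ℂ} {a : ℕ → ℂ} {δ : ℝ}
    (hf : HasDirichletSeries f a) (hδ : 0 < δ) (hfδ : ∀ s, δ ≤ ‖f s‖)
    (S : Subsemigroup ℕ+) (hS : ∀ n : ℕ+, n ∉ S → a n = 0) :
    ∃ b : ℕ → ℂ, HasDirichletSeries f⁻¹ b ∧ ∀ n : ℕ+, n ∉ S → b n = 0 := by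
  obtain ⟨A, hA⟩ := hf.exists_norm_coeff_le
  let α : ArithmeticFunction ℂ := toArithmeticFunction a
  have hα : ∀ n : ℕ, n ≠ 0 → α n = a n := fun n hn => if_neg hn
  have hαA : ∀ n : ℕ, ‖α n‖ ≤ A * n := fun n => by
    rcases eq_or_ne n 0 with rfl | hn
    · simp
    · exact hα n hn ▸ hA n hn
  have hαsum : ∀ s : ℂ, 2 < s.re → LSeriesSummable (α ·) s := fun s hs =>
    LSeriesSummable_of_le_const_mul_rpow hs ⟨A, fun n hn => (hαA n).trans_eq (by norm_num)⟩
  have hαF : ∀ s : ℂ, 2 < s.re → LSeries (α ·) s = extendByZero f s := fun s hs => by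
    refine tendsto_nhds_unique (hαsum s hs).tendsto_sum_Icc
      ((hf.tendsto_extendByZero (by linarith)).congr fun N => Finset.sum_congr rfl fun n hn => ?_)
    rw [hα n (by have := (Finset.mem_Icc.mp hn).1; lia)]
  have hFδ : ∀ s : ℂ, 0 < s.re → δ ≤ ‖extendByZero f s‖ := fun s hs =>
    extendByZero_of_pos f hs ▸ hfδ _
  have hFne : ∀ s : ℂ, 0 < s.re → extendByZero f s ≠ 0 := fun s hs =>
    norm_pos_iff.mp (hδ.trans_le (hFδ s hs))
  have hα1 : α 1 ≠ 0 := by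
    have hlim := (LSeries.tendsto_atTop (f := (α ·)) ((hαsum 3 (by norm_num)
      ).abscissaOfAbsConv_le.trans_lt (EReal.coe_lt_top _))).norm
    refine norm_pos_iff.mp (hδ.trans_le (ge_of_tendsto hlim ?_))
    filter_upwards [eventually_gt_atTop 2] with x hx
    rw [hαF x (by simpa using hx)]
    exact hFδ x (by rw [Complex.ofReal_re]; linarith)
  let hinv : Invertible (α 1) := invertibleOfNonzero hα1
  let β := ArithmeticFunction.dirichletInverse α hinv
  obtain ⟨C, k, hC⟩ := ArithmeticFunction.exists_norm_dirichletInverse_le α hinv hαA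
  -- Coefficients `O(n ^ k)` already give `Re s > k + 1`; the extra `1` also puts `s` where the
  -- series of `α` converges absolutely.
  have hβsum : ∀ s : ℂ, (k : ℝ) + 2 < s.re → LSeriesSummable (β ·) s := fun s hs =>
    LSeriesSummable_of_le_const_mul_rpow (x := k + 1) (by linarith)
      ⟨C, fun n hn => (hC n).trans_eq (by simp)⟩
  have hβF : ∀ s : ℂ, (k : ℝ) + 2 < s.re → LSeries (β ·) s = (extendByZero f s)⁻¹ :=
    fun s hs => by
      have hk : (0 : ℝ) ≤ k := Nat.cast_nonneg k
      have hs2 : 2 < s.re := by linarith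
      have h := ArithmeticFunction.LSeries_mul' (hαsum s hs2) (hβsum s hs)
      rw [ArithmeticFunction.self_mul_dirichletInverse, hαF s hs2,
        ArithmeticFunction.one_eq_delta, LSeries_delta, Pi.one_apply] at h
      exact (inv_eq_of_mul_eq_one_right h.symm).symm
  refine ⟨β, fun s => ?_, ArithmeticFunction.dirichletInverse_eq_zero_of_notMem α hinv S
    fun n hn => (hα n n.ne_zero).trans (hS n hn)⟩
  have h := tendsto_sum_Icc_of_bounded (F := fun s => (extendByZero f s)⁻¹) (M := δ⁻¹)
    (hf.differentiableOn.inv hFne)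
    (fun s hs => by rw [norm_inv]; exact inv_anti₀ hδ (hFδ s hs)) hβsum hβF s.2
  rwa [extendByZero_of_pos f s.2] at h

theorem mainTheorem2 (S : Subsemigroup ℕ+) :
    invertibleIn (DirichletHInftyOn (S : Set ℕ+)) =
      {f ∈ DirichletHInftyOn (S : Set ℕ+) | 0 < ⨅ s : RightHalfPlane, ‖f s‖} := by
  have : Nonempty RightHalfPlane := ⟨⟨1, by simp⟩⟩
  ext f
  refine and_congr_right fun hf => ⟨?_, fun hpos => ?_⟩
  · rintro ⟨g, ⟨⟨-, M, hM⟩, -⟩, hfg⟩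
    have h1 : ∀ s, ‖f s‖ * ‖g s‖ = 1 := fun s => by
      rw [← norm_mul, ← Pi.mul_apply, hfg, Pi.one_apply, norm_one]
    have hgM : ∀ s, ‖g s‖ ≤ M := fun s => hM ⟨s, rfl⟩
    have hg0 : ∀ s, 0 < ‖g s‖ := fun s =>
      (norm_nonneg _).lt_of_ne fun h => by simpa [← h] using h1 s
    have hM0 : 0 < M := (hg0 ⟨1, by simp⟩).trans_le (hgM _)
    refine (inv_pos.mpr hM0).trans_le (le_ciInf fun s => ?_)
    rw [eq_inv_of_mul_eq_one_left (h1 s)]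
    exact inv_anti₀ (hg0 s) (hgM s)
  · obtain ⟨-, a, ha, haS⟩ := hf
    have hδ : ∀ s, (⨅ s : RightHalfPlane, ‖f s‖) ≤ ‖f s‖ := fun s =>
      ciInf_le ⟨0, by rintro _ ⟨s, rfl⟩; exact norm_nonneg _⟩ s
    obtain ⟨b, hb, hbS⟩ := exists_hasDirichletSeries_inv ha hpos hδ S haS
    refine ⟨f⁻¹, ⟨⟨⟨b, hb⟩, (⨅ s : RightHalfPlane, ‖f s‖)⁻¹, ?_⟩, b, hb, hbS⟩, ?_⟩
    · rintro _ ⟨s, rfl⟩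
      simp only [Pi.inv_apply, norm_inv]
      exact inv_anti₀ hpos (hδ s)
    · ext s
      exact mul_inv_cancel₀ (norm_pos_iff.mp (hpos.trans_le (hδ s)))
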